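/- Let $\Gamma$ be a compact Lie group acting linearly on $\mathbb R^n$, let $f:\mathbb R^n\to\mathbb R^n$ be a $C^1$ vector field that is $\Gamma$-equivariant, $f(\gamma x)=\gamma f(x)$ for all $\gamma\in\Gamma$, $x\in\mathbb R^n$, and write $\Phi_t$ for the (possibly only local) flow of $\dot x=f(x)$. For an equilibrium $\xi$ let $W^u(\xi)$ and $W^s(\xi)$ be the sets of points whose trajectory exists for all $t\le 0$, respectively all $t\ge 0$, and converges to $\xi$ as $t\to-\infty$, respectively $t\to+\infty$. A one-dimensional connection from $\xi$ to $\eta$ is a nonconstant trajectory contained in $W^u(\xi)\cap W^s(\eta)$. A heteroclinic cycle consists of equilibria $\xi_1,\dots,\xi_{m+1}$ ($m\ge1$) with $\xi_{m+1}=\gamma\xi_1$ for some $\gamma\in\Gamma$, together with a connection from $\xi_j$ to $\xi_{j+1}$ for each $j=1,\dots,m$. A heteroclinic network is a connected set that is the union of heteroclinic cycles, at least two of which are different after identification of points in the same $\Gamma$-orbit. For a set $X$ and $\delta>0$ let $\mathcal B_\delta(X)$ be the set of points $x$ such that $\Phi_t(x)$ exists for all $t\ge0$, $d(\Phi_t(x),X)<\delta$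 for all $t>0$, and $d(\Phi_t(x),X)\to0$ as $t\to+\infty$; $X$ is asymptotically stable if for every $\delta>0$ there is $\varepsilon>0$ such that the $\varepsilon$-neighbourhood of $X$ is contained in $\mathcal B_\delta(X)$. Let $X\subset\mathbb R^n$ be a compact heteroclinic network comprised of equilibria $\xi_j$ and a finite number of one-dimensional connections (symmetric copies being counted separately). $X$ may be robust, i.e. persistent under $\Gamma$-equivariant perturbations of $f$, but this is not required. Suppose that some equilibrium $\xi_j\in X$ satisfies $\dim W^u(\xi_j)\ge2$, where $\dim$ is the Hausdorff dimension (which is the usual dimension when $W^u(\xi_j)$ is an injectively immersed $C^1$ manifold, as it is for hyperbolic $\xi_j$). Then $X$ is not asymptotically stable. -/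

import Mathlib

open Set Filter Topology

noncomputable section

namespace Heteroclinic

/-- Euclidean space `ℝⁿ`. -/
abbrev Space (n : ℕ) : Type := EuclideanSpace ℝ (Fin n)

variable {n : ℕ}

/-- `x` is an equilibrium of the autonomous equation `x' = f x`. -/
def IsEquilibrium (f : Space n → Space n) (x : Space n) : Prop := f x = 0

/-- The unstable manifold `W^u(ξ)`, as a subset of phase space: the points whose backward trajectory
is defined for all negative times and converges to `ξ`. -/
def unstableManifold (f : Space n → Space n) (ξ : Space n) : Set (Space n) :=
  {x | ∃ φ : ℝ → Space n, IsIntegralCurveOn φ (fun _ => f) (Iic 0) ∧ φ 0 = x ∧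
    Tendsto φ atBot (𝓝 ξ)}

/-- The stable manifold `W^s(ξ)`, as a subset of phase space: the points whose forward trajectory
is defined for all positive times and converges to `ξ`. -/
def stableManifold (f : Space n → Space n) (ξ : Space n) : Set (Space n) :=
  {x | ∃ φ : ℝ → Space n, IsIntegralCurveOn φ (fun _ => f) (Ici 0) ∧ φ 0 = x ∧
    Tendsto φ atTop (𝓝 ξ)}

/-- `κ` is a (one-dimensional) connection `[ξ → η]`: a single nonconstant trajectory contained in
`W^u(ξ) ∩ W^s(η)`. -/
def IsConnection (f : Space n → Space n) (ξ η : Space n) (κ : Set (Space n)) : Prop :=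
  (∃ φ : ℝ → Space n, IsIntegralCurve φ (fun _ => f) ∧ ¬ IsEquilibrium f (φ 0) ∧ κ = range φ) ∧
    κ ⊆ unstableManifold f ξ ∩ stableManifold f η

/-- A heteroclinic cycle of `f` with respect to the symmetry group `Γ`: equilibria
`ξ 0, …, ξ m` with `m ≥ 1` and connections `κ j = [ξ j → ξ (j + 1)]`, closing up modulo `Γ`,
that is, with `ξ m = γ • ξ 0` for some `γ ∈ Γ`. -/
structure Cycle (Γ : Type*) [Group Γ] [DistribMulAction Γ (Space n)]
    (f : Space n → Space n) where
  m : ℕ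
  m_pos : 0 < m
  ξ : Fin (m + 1) → Space n
  κ : Fin m → Set (Space n)
  isEquilibrium : ∀ i, IsEquilibrium f (ξ i)
  isConnection : ∀ j : Fin m, IsConnection f (ξ j.castSucc) (ξ j.succ) (κ j)
  closes : ∃ γ : Γ, ξ (Fin.last m) = γ • ξ 0

/-- The set of points of a cycle. -/
def Cycle.carrier {Γ : Type*} [Group Γ] [DistribMulAction Γ (Space n)]
    {f : Space n → Space n} (C : Cycle Γ f) : Set (Space n) :=
  range C.ξ ∪ ⋃ j, C.κ j

/-- The union of all images of a set under the symmetry group. -/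
def saturation (Γ : Type*) [Group Γ] [DistribMulAction Γ (Space n)] (S : Set (Space n)) :
    Set (Space n) :=
  {x | ∃ γ : Γ, ∃ y ∈ S, x = γ • y}

/-- A heteroclinic network: a connected set that is the union of a family of heteroclinic cycles,
at least two of which differ after identification of points in the same `Γ`-orbit. -/
structure Network (Γ : Type*) [Group Γ] [DistribMulAction Γ (Space n)]
    (f : Space n → Space n) where
  cycles : Set (Cycle Γ f)
  two_cycles : ∃ C ∈ cycles, ∃ C' ∈ cycles, saturation Γ C.carrier ≠ saturation Γ C'.carrier
  isConnected : IsConnected (⋃ C ∈ cycles, C.carrier)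

namespace Network

variable {Γ : Type*} [Group Γ] [DistribMulAction Γ (Space n)] {f : Space n → Space n}

/-- The set of points of a network. -/
def carrier (N : Network Γ f) : Set (Space n) := ⋃ C ∈ N.cycles, C.carrier

/-- The equilibria of a network. -/
def equilibria (N : Network Γ f) : Set (Space n) := {x | ∃ C ∈ N.cycles, ∃ i, x = C.ξ i}

/-- The connections of a network; symmetric copies that are different trajectories are different
elements. -/
def connections (N : Network Γ f) : Set (Set (Space n)) :=
  {κ | ∃ C ∈ N.cycles, ∃ j, κ = C.κ j}

end Network

/-- The dimension of `W^u(ξ)`, taken as the Hausdorff dimension of the set. It is defined without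
any hyperbolicity assumption and equals `k` when `W^u(ξ)` is an injectively immersed `C¹`
submanifold of dimension `k`. -/
def unstableDim (f : Space n → Space n) (ξ : Space n) : ENNReal := dimH (unstableManifold f ξ)

/-- The `δ`-basin of attraction of `X`: the points whose forward trajectory is defined for all
positive times, remains at distance less than `δ` from `X`, and converges to `X`. -/
def basin (f : Space n → Space n) (δ : ℝ) (X : Set (Space n)) : Set (Space n) :=
  {x | ∃ φ : ℝ → Space n, IsIntegralCurveOn φ (fun _ => f) (Ici 0) ∧ φ 0 = x ∧
    (∀ t > 0, Metric.infDist (φ t) X < δ) ∧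
    Tendsto (fun t => Metric.infDist (φ t) X) atTop (𝓝 0)}

/-- Asymptotic stability: every `δ`-basin contains an `ε`-neighbourhood of `X`. -/
def AsymptoticallyStable (f : Space n → Space n) (X : Set (Space n)) : Prop :=
  ∀ δ > 0, ∃ ε > 0, Metric.thickening ε X ⊆ basin f δ X

end Heteroclinic

end

open Set Filter Topology

namespace Heteroclinic

/-! A stable closed set contains the unstable manifold of each of its points
(`AsymptoticallyStable.unstableManifold_subset`). Indeed, a point of `W^u(ξ)` outside the set would
be reached, at a fixed positive distance, from initial points arbitrarily close to `ξ`. But the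
network is too thin to contain a set of dimension 2: each connection is a `C¹` curve and the
equilibria are finite in number, so its Hausdorff dimension is at most 1
(`Network.dimH_carrier_le_one`). Uniqueness of solutions serves both halves: it identifies the
trajectories in the first and bounds the number of equilibria in the second. -/

section Uniqueness

variable {E : Type*} [NormedAddCommGroup E] {f : E → E} {φ ψ : ℝ → E} {a b : ℝ}

/-- Two curves that are continuous on a compact interval take values in a common set on which a
locally Lipschitz map is Lipschitz. -/
theorem exists_lipschitzOnWith_of_continuousOn_Icc (hf : LocallyLipschitz f)
    (hφ : ContinuousOn φ (Icc a b)) (hψ : ContinuousOn ψ (Icc a b)) :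
    ∃ K, LipschitzOnWith K f (φ '' Icc a b ∪ ψ '' Icc a b) :=
  LocallyLipschitzOn.exists_lipschitzOnWith_of_compact
    ((isCompact_Icc.image_of_continuousOn hφ).union (isCompact_Icc.image_of_continuousOn hψ))
    hf.locallyLipschitzOn

variable [NormedSpace ℝ E]

/-- Integral curves of a locally Lipschitz vector field that agree at the left end of a compact
interval agree on the interval. -/
theorem eqOn_Icc_of_eq_left (hf : LocallyLipschitz f)
    (hφ : IsIntegralCurveOn φ (fun _ => f) (Icc a b))
    (hψ : IsIntegralCurveOn ψ (fun _ => f) (Icc a b)) (h : φ a = ψ a) :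
    EqOn φ ψ (Icc a b) := by
  obtain ⟨K, hK⟩ := exists_lipschitzOnWith_of_continuousOn_Icc hf hφ.continuousOn hψ.continuousOn
  -- The constraint set is the union of the two compact traces, so a Lipschitz bound there suffices.
  exact ODE_solution_unique_of_mem_Icc_right (v := fun _ => f)
    (s := fun _ => φ '' Icc a b ∪ ψ '' Icc a b) (fun _ _ => hK) hφ.continuousOn
    (fun t ht => (hφ t (Ico_subset_Icc_self ht)).mono_of_mem_nhdsWithin
      (Icc_mem_nhdsGE_of_mem ht))
    (fun t ht => Or.inl (mem_image_of_mem φ (Ico_subset_Icc_self ht))) hψ.continuousOn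
    (fun t ht => (hψ t (Ico_subset_Icc_self ht)).mono_of_mem_nhdsWithin
      (Icc_mem_nhdsGE_of_mem ht))
    (fun t ht => Or.inr (mem_image_of_mem ψ (Ico_subset_Icc_self ht))) h

/-- Integral curves of a locally Lipschitz vector field that agree at the right end of a compact
interval agree on the interval. -/
theorem eqOn_Icc_of_eq_right (hf : LocallyLipschitz f)
    (hφ : IsIntegralCurveOn φ (fun _ => f) (Icc a b))
    (hψ : IsIntegralCurveOn ψ (fun _ => f) (Icc a b)) (h : φ b = ψ b) :
    EqOn φ ψ (Icc a b) := by
  obtain ⟨K, hK⟩ := exists_lipschitzOnWith_of_continuousOn_Icc hf hφ.continuousOn hψ.continuousOn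
  exact ODE_solution_unique_of_mem_Icc_left (v := fun _ => f)
    (s := fun _ => φ '' Icc a b ∪ ψ '' Icc a b) (fun _ _ => hK) hφ.continuousOn
    (fun t ht => (hφ t (Ioc_subset_Icc_self ht)).mono_of_mem_nhdsWithin
      (Icc_mem_nhdsLE_of_mem ht))
    (fun t ht => Or.inl (mem_image_of_mem φ (Ioc_subset_Icc_self ht))) hψ.continuousOn
    (fun t ht => (hψ t (Ioc_subset_Icc_self ht)).mono_of_mem_nhdsWithin
      (Icc_mem_nhdsLE_of_mem ht))
    (fun t ht => Or.inr (mem_image_of_mem ψ (Ioc_subset_Icc_self ht))) h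

/-- An integral curve of a continuous vector field is `C¹`. -/
theorem contDiff_of_isIntegralCurve (hf : Continuous f) (hφ : IsIntegralCurve φ (fun _ => f)) :
    ContDiff ℝ 1 φ := by
  refine contDiff_one_iff_deriv.2 ⟨fun t => (hφ t).differentiableAt, ?_⟩
  rw [show deriv φ = f ∘ φ from funext fun t => (hφ t).deriv]
  exact hf.comp hφ.continuous

end Uniqueness

variable {n : ℕ} {f : Space n → Space n} {ξ ξ₂ η η₂ x : Space n} {κ : Set (Space n)}

/-- A point lies in the stable manifold of at most one point. -/
theorem eq_of_mem_stableManifold (hf : LocallyLipschitz f) (h : x ∈ stableManifold f η)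
    (h₂ : x ∈ stableManifold f η₂) : η = η₂ := by
  obtain ⟨φ, hφ, hφ0, hφl⟩ := h
  obtain ⟨ψ, hψ, hψ0, hψl⟩ := h₂
  refine tendsto_nhds_unique (hφl.congr' ?_) hψl
  filter_upwards [eventually_ge_atTop 0] with t ht
  exact eqOn_Icc_of_eq_left hf (hφ.mono Icc_subset_Ici_self) (hψ.mono Icc_subset_Ici_self)
    (hφ0.trans hψ0.symm) (right_mem_Icc.2 ht)

/-- A point lies in the unstable manifold of at most one point. -/
theorem eq_of_mem_unstableManifold (hf : LocallyLipschitz f) (h : x ∈ unstableManifold f ξ)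
    (h₂ : x ∈ unstableManifold f ξ₂) : ξ = ξ₂ := by
  obtain ⟨φ, hφ, hφ0, hφl⟩ := h
  obtain ⟨ψ, hψ, hψ0, hψl⟩ := h₂
  refine tendsto_nhds_unique (hφl.congr' ?_) hψl
  filter_upwards [eventually_le_atBot 0] with t ht
  exact eqOn_Icc_of_eq_right hf (hφ.mono Icc_subset_Iic_self) (hψ.mono Icc_subset_Iic_self)
    (hφ0.trans hψ0.symm) (left_mem_Icc.2 ht)

theorem IsConnection.nonempty (h : IsConnection f ξ η κ) : κ.Nonempty := by
  obtain ⟨⟨φ, -, -, rfl⟩, -⟩ := h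
  exact range_nonempty φ

/-- A connection has only one source. -/
theorem IsConnection.source_eq (hf : LocallyLipschitz f) (h : IsConnection f ξ η κ)
    (h₂ : IsConnection f ξ₂ η₂ κ) : ξ = ξ₂ :=
  let ⟨_, hx⟩ := h.nonempty
  eq_of_mem_unstableManifold hf (h.2 hx).1 (h₂.2 hx).1

/-- A connection has only one target. -/
theorem IsConnection.target_eq (hf : LocallyLipschitz f) (h : IsConnection f ξ η κ)
    (h₂ : IsConnection f ξ₂ η₂ κ) : η = η₂ :=
  let ⟨_, hx⟩ := h.nonempty
  eq_of_mem_stableManifold hf (h.2 hx).2 (h₂.2 hx).2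

/-- A `C¹` image of `ℝ` has dimension at most that of `ℝ`. -/
theorem IsConnection.dimH_le_one (hf : Continuous f) (h : IsConnection f ξ η κ) :
    dimH κ ≤ 1 := by
  obtain ⟨⟨φ, hφ, -, rfl⟩, -⟩ := h
  simpa using (contDiff_of_isIntegralCurve hf hφ).dimH_range_le

/-- If `X` is asymptotically stable, it contains the unstable manifold of each of its points. -/
theorem AsymptoticallyStable.unstableManifold_subset {X : Set (Space n)}
    (hf : LocallyLipschitz f) (hX : IsClosed X) (h : AsymptoticallyStable f X) (hξ : ξ ∈ X) :
    unstableManifold f ξ ⊆ X := by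
  rintro x ⟨φ, hφ, hφ0, hφl⟩
  by_contra hx
  -- Take `δ` to be the distance from `x` to `X`, so that `x` itself violates the strict bound of
  -- the `δ`-basin.
  obtain ⟨ε, hε, hsub⟩ := h _ ((hX.notMem_iff_infDist_pos ⟨ξ, hξ⟩).1 hx)
  have hnear : ∀ᶠ t in atBot, φ t ∈ Metric.thickening ε X :=
    hφl.eventually (Metric.isOpen_thickening.mem_nhds (Metric.self_subset_thickening hε X hξ))
  obtain ⟨s, hs, hs0⟩ := (hnear.and (eventually_lt_atBot 0)).exists
  obtain ⟨ψ, hψ, hψ0, hψδ, -⟩ := hsub hs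
  -- The basin trajectory `ψ` starts at `φ s`; delayed by `s`, it must follow `φ` and reach `x` at
  -- time `0`.
  have hshift : IsIntegralCurveOn (ψ ∘ (· - s)) (fun _ => f) (Icc s 0) := by
    refine (hψ.comp_sub s).mono fun t ht => mem_vadd_set.2 ⟨t - s, sub_nonneg.2 ht.1, ?_⟩
    simp
  have heq := eqOn_Icc_of_eq_left hf (hφ.mono Icc_subset_Iic_self) hshift (by simp [hψ0])
    (right_mem_Icc.2 hs0.le)
  have hlt := hψδ (0 - s) (sub_pos.2 hs0)
  rw [← show φ 0 = ψ (0 - s) from heq, hφ0] at hlt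
  exact lt_irrefl _ hlt

namespace Network

variable {Γ : Type*} [Group Γ] [DistribMulAction Γ (Space n)] (N : Network Γ f)

theorem exists_isConnection {κ : Set (Space n)} (hκ : κ ∈ N.connections) :
    ∃ ξ η, IsConnection f ξ η κ := by
  obtain ⟨C, -, j, rfl⟩ := hκ
  exact ⟨_, _, C.isConnection j⟩

/-- Every equilibrium of a network is an end of one of its connections. -/
theorem exists_isConnection_of_mem_equilibria {x : Space n} (hx : x ∈ N.equilibria) :
    ∃ κ ∈ N.connections, (∃ η, IsConnection f x η κ) ∨ ∃ ξ, IsConnection f ξ x κ := by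
  obtain ⟨C, hC, i, rfl⟩ := hx
  induction i using Fin.lastCases with
  | last =>
    -- No indexed connection leaves the last equilibrium; the one entering it exists because `m ≥
    -- 1`.
    have hlast : (⟨C.m - 1, Nat.sub_one_lt_of_lt C.m_pos⟩ : Fin C.m).succ = Fin.last C.m :=
      Fin.ext (Nat.sub_add_cancel C.m_pos)
    exact ⟨_, ⟨C, hC, _, rfl⟩, Or.inr ⟨_, hlast ▸ C.isConnection _⟩⟩
  | cast j => exact ⟨_, ⟨C, hC, j, rfl⟩, Or.inl ⟨_, C.isConnection j⟩⟩

/-- A network with finitely many connections has finitely many equilibria. -/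
theorem finite_equilibria (hf : LocallyLipschitz f) (hN : N.connections.Finite) :
    N.equilibria.Finite := by
  -- Each connection accounts for at most two equilibria, its source and its target.
  refine (hN.biUnion (t := fun κ => {x | ∃ η, IsConnection f x η κ} ∪
    {x | ∃ ξ, IsConnection f ξ x κ}) fun κ _ => Finite.union ?_ ?_).subset fun x hx => ?_
  · exact Set.Subsingleton.finite fun _ ⟨_, h⟩ _ ⟨_, h₂⟩ => h.source_eq hf h₂
  · exact Set.Subsingleton.finite fun _ ⟨_, h⟩ _ ⟨_, h₂⟩ => h.target_eq hf h₂
  · obtain ⟨κ, hκ, h⟩ := N.exists_isConnection_of_mem_equilibria hx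
    exact mem_biUnion hκ h

theorem equilibria_subset_carrier : N.equilibria ⊆ N.carrier := by
  rintro x ⟨C, hC, i, rfl⟩
  exact mem_biUnion hC (Or.inl (mem_range_self i))

theorem carrier_subset : N.carrier ⊆ N.equilibria ∪ ⋃₀ N.connections := by
  refine iUnion₂_subset fun C hC => union_subset ?_ (iUnion_subset fun j => ?_)
  · rintro _ ⟨i, rfl⟩
    exact Or.inl ⟨C, hC, i, rfl⟩
  · have hj : C.κ j ∈ N.connections := ⟨C, hC, j, rfl⟩
    exact (subset_sUnion_of_mem hj).trans subset_union_right

/-- A network with finitely many connections has Hausdorff dimension at most one. -/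
theorem dimH_carrier_le_one (hf : LocallyLipschitz f) (hN : N.connections.Finite) :
    dimH N.carrier ≤ 1 := by
  refine (dimH_mono N.carrier_subset).trans ?_
  rw [dimH_union, (N.finite_equilibria hf hN).dimH_zero, dimH_sUnion hN.countable]
  refine max_le zero_le_one (iSup₂_le fun κ hκ => ?_)
  obtain ⟨ξ, η, h⟩ := N.exists_isConnection hκ
  exact h.dimH_le_one hf.continuous

end Network

end Heteroclinic

theorem corollary3p2 {n : ℕ} {Γ : Type*} [Group Γ] [TopologicalSpace Γ] [IsTopologicalGroup Γ]
    [CompactSpace Γ] [DistribMulAction Γ (Heteroclinic.Space n)]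
    [SMulCommClass Γ ℝ (Heteroclinic.Space n)] [ContinuousSMul Γ (Heteroclinic.Space n)]
    (f : Heteroclinic.Space n → Heteroclinic.Space n) (hf : ContDiff ℝ 1 f)
    (hequiv : ∀ (γ : Γ) (x : Heteroclinic.Space n), f (γ • x) = γ • f x)
    (N : Heteroclinic.Network Γ f) (hcompact : IsCompact N.carrier)
    (hfinite : N.connections.Finite)
    (hdim : ∃ ξ ∈ N.equilibria, 2 ≤ Heteroclinic.unstableDim f ξ) :
    ¬ Heteroclinic.AsymptoticallyStable f N.carrier := by
  intro hstable
  obtain ⟨ξ, hξ, h2⟩ := hdim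
  have hlip : LocallyLipschitz f := hf.locallyLipschitz
  have hsub := hstable.unstableManifold_subset hlip hcompact.isClosed
    (N.equilibria_subset_carrier hξ)
  exact absurd (h2.trans ((dimH_mono hsub).trans (N.dimH_carrier_le_one hlip hfinite)))
    (not_le.2 ENNReal.one_lt_two)
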